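/- Conventions. $S_\infty$ is the group of all permutations of a countably infinite set, with the topology of pointwise convergence (the set being discrete); a topological group is called a subgroup of $S_\infty$ if it is isomorphic, as a topological group, to a topological (not necessarily closed) subgroup of $S_\infty$. A topological group $G$ is Roelcke precompact if for every neighbourhood $U$ of the identity there is a finite set $F \subseteq G$ with $G = UFU$. It is oligomorphic if it can be realized as a topological subgroup of the permutation group of a countable (finite or infinite) set $X$ such that, for every $n$, the diagonal action on $X^n$ has only finitely many orbits. A unitary representation of $G$ is a homomorphism $\pi$ from $G$ to the unitary group of a complex Hilbert space $\mathcal H(\pi)$; it is continuous if $g \mapsto \pi(g)\xi$ is continuous for every $\xi \in \mathcal H(\pi)$, and irreducible if $\mathcal H(\pi) \ne 0$ and $\mathcal H(\pi)$ has no closed invariant subspaces other than $0$ and $\mathcal H(\pi)$. For a subgroup $V \le G$ put $$\mathrm{Comm}_G(V) = \{ g \in G : V \cap gVg^{-1} \text{ has finite index in both } V \text{ and } gVg^{-1} \}.$$ For an open subgroup $H \le G$ and a unitary representation $\sigma$ of $H$, $\mathrm{Ind}_H^G(\sigma)$ is the representation $(g \cdot f)(x) = f(g^{-1}x)$ of $G$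 on the Hilbert space of all $f \colon G \to \mathcal H(\sigma)$ with $f(gh) = \sigma(h^{-1})f(g)$ for $g \in G$, $h \in H$ and $\|f\|^2 = \sum_{t \in T} \|f(t)\|^2 < \infty$, where $T$ is a system of representatives of the left cosets of $H$ in $G$ (the choice of $T$ does not matter). **Theorem.** Every oligomorphic group is a Roelcke precompact subgroup of $S_\infty$. Let $G$ be any Roelcke precompact subgroup of $S_\infty$. Then: 1. Every continuous unitary representation of $G$ is an orthogonal Hilbert space direct sum of irreducible subrepresentations, each of which has the form described in 2. 2. Every irreducible continuous unitary representation of $G$ is unitarily equivalent to $\mathrm{Ind}_H^G(\sigma)$, where $V \le G$ is an open subgroup, $H = \mathrm{Comm}_G(V)$ is open with $\mathrm{Comm}_G(H) = H$, $V$ is normal and of finite index in $H$, and $\sigma$ is an irreducible unitary representation of the finite group $H/V$, regarded as a representation of $H$. -/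

import Mathlib

open scoped Pointwise Topology ENNReal

universe u v

noncomputable section

/-! ### Permutation groups -/

/-- The topology of pointwise convergence on the group of all permutations of a set `X`,
where `X` carries the discrete topology. -/
instance permTopology (X : Type*) : TopologicalSpace (Equiv.Perm X) :=
  TopologicalSpace.induced (fun g : Equiv.Perm X => (g : X → X))
    (@Pi.topologicalSpace X (fun _ => X) (fun _ => ⊥))

/-- `G` is (isomorphic, as a topological group, to) a topological subgroup of `S_∞`, the group of
all permutations of a countably infinite set. -/
def IsSubgroupOfSInfty (G : Type*) [Group G] [TopologicalSpace G] : Prop :=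
  ∃ ρ : G →* Equiv.Perm ℕ, Topology.IsEmbedding ρ

/-- A topological group is oligomorphic if it can be realized as a topological subgroup of the
permutation group of a countable (finite or infinite) set `X` in such a way that for every `n` the
diagonal action on `X ^ n` has only finitely many orbits. -/
def IsOligomorphic (G : Type*) [Group G] [TopologicalSpace G] : Prop :=
  ∃ (X : Type) (_ : Countable X) (ρ : G →* Equiv.Perm X), Topology.IsEmbedding ρ ∧
    ∀ n : ℕ, {O : Set (Fin n → X) | ∃ x : Fin n → X,
      O = Set.range fun (g : G) (i : Fin n) => ρ g (x i)}.Finite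

/-- A topological group is Roelcke precompact if for every neighbourhood `U` of the identity there
is a finite set `F` with `G = U F U`. -/
def IsRoelckePrecompact (G : Type*) [Group G] [TopologicalSpace G] : Prop :=
  ∀ U ∈ 𝓝 (1 : G), ∃ F : Set G, F.Finite ∧ U * F * U = Set.univ

/-! ### Unitary representations -/

section Rep

variable {G : Type*} [Group G]
  {E : Type*} [NormedAddCommGroup E] [InnerProductSpace ℂ E]
  {F : Type*} [NormedAddCommGroup F] [InnerProductSpace ℂ F]

/-- Strong continuity of a unitary representation: all orbit maps are continuous. -/
def IsContinuousRep [TopologicalSpace G] (π : G →* (E ≃ₗᵢ[ℂ] E)) : Prop :=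
  ∀ ξ : E, Continuous fun g : G => π g ξ

/-- The subspace `K` is invariant under the representation `π`. -/
def IsInvariantSubspace (π : G →* (E ≃ₗᵢ[ℂ] E)) (K : Submodule ℂ E) : Prop :=
  ∀ g : G, ∀ ξ ∈ K, π g ξ ∈ K

/-- A unitary representation is irreducible if its space is non-zero and has no closed invariant
subspaces other than zero and the whole space. -/
def IsIrreducibleRep (π : G →* (E ≃ₗᵢ[ℂ] E)) : Prop :=
  Nontrivial E ∧ ∀ K : Submodule ℂ E, IsClosed (K : Set E) → IsInvariantSubspace π K →
    K = ⊥ ∨ K = ⊤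

/-- Unitary equivalence of unitary representations. -/
def AreUnitarilyEquivalent (π : G →* (E ≃ₗᵢ[ℂ] E)) (ρ : G →* (F ≃ₗᵢ[ℂ] F)) : Prop :=
  ∃ U : E ≃ₗᵢ[ℂ] F, ∀ (g : G) (ξ : E), U (π g ξ) = ρ g (U ξ)

/-- The subrepresentation of `π` on an invariant subspace `K`. -/
def subRep (π : G →* (E ≃ₗᵢ[ℂ] E)) (K : Submodule ℂ E) (hK : IsInvariantSubspace π K) :
    G →* (K ≃ₗᵢ[ℂ] K) where
  toFun g :=
    { toFun := fun ξ => ⟨π g ξ, hK g ξ ξ.2⟩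
      invFun := fun ξ => ⟨π g⁻¹ ξ, hK g⁻¹ ξ ξ.2⟩
      map_add' := fun ξ η => Subtype.ext (by simp)
      map_smul' := fun c ξ => Subtype.ext (by simp)
      left_inv := fun ξ => Subtype.ext (by simp)
      right_inv := fun ξ => Subtype.ext (by simp)
      norm_map' := fun ξ => (π g).norm_map ξ }
  map_one' := by ext ξ; simp
  map_mul' g h := by ext ξ; simp

end Rep

/-! ### Induced representations -/

section Ind

variable {G : Type*} [Group G] {H : Subgroup G}
  {F : Type*} [NormedAddCommGroup F] [InnerProductSpace ℂ F]

/-- The functions `f : G → F` with `f (g h) = σ(h⁻¹) f(g)` for `g ∈ G`, `h ∈ H`, that are square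
summable over a system of representatives of the left cosets of `H`. -/
def indSubmodule (σ : H →* (F ≃ₗᵢ[ℂ] F)) : Submodule ℂ (G → F) where
  carrier := {f | (∀ (g : G) (h : H), f (g * h) = σ h⁻¹ (f g)) ∧
    Memℓp (fun q : G ⧸ H => f q.out) 2}
  zero_mem' := ⟨fun g h => by simp, zero_memℓp⟩
  add_mem' := fun {f f'} hf hf' =>
    ⟨fun g h => by simp only [Pi.add_apply, hf.1, hf'.1, map_add], hf.2.add hf'.2⟩
  smul_mem' := fun c f hf =>
    ⟨fun g h => by simp only [Pi.smul_apply, hf.1, map_smul], hf.2.const_smul c⟩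

/-- The space of the induced representation `Ind_H^G(σ)`. -/
def IndSpace (σ : H →* (F ≃ₗᵢ[ℂ] F)) := ↥(indSubmodule σ)

namespace IndSpace

variable {σ : H →* (F ≃ₗᵢ[ℂ] F)}

instance : AddCommGroup (IndSpace σ) := inferInstanceAs (AddCommGroup (indSubmodule σ))

instance : Module ℂ (IndSpace σ) := inferInstanceAs (Module ℂ (indSubmodule σ))

instance : FunLike (IndSpace σ) G F where
  coe f := f.1
  coe_injective _ _ h := Subtype.ext h

@[ext]
theorem ext {f f' : IndSpace σ} (h : ∀ x, f x = f' x) : f = f' := DFunLike.ext f f' h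

@[simp]
theorem add_apply (f f' : IndSpace σ) (x : G) : (f + f') x = f x + f' x := rfl

@[simp]
theorem smul_apply (c : ℂ) (f : IndSpace σ) (x : G) : (c • f) x = c • f x := rfl

theorem apply_mul (f : IndSpace σ) (g : G) (h : H) : f (g * h) = σ h⁻¹ (f g) := f.2.1 g h

/-- The norm of `f x` depends only on the left coset of `x`. -/
theorem norm_apply_eq (f : IndSpace σ) {x y : G} (h : (x : G ⧸ H) = y) : ‖f x‖ = ‖f y‖ := by
  have hm : x⁻¹ * y ∈ H := QuotientGroup.eq.1 h
  have := f.apply_mul x ⟨x⁻¹ * y, hm⟩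
  simp only [mul_inv_cancel_left] at this
  rw [this, LinearIsometryEquiv.norm_map]

theorem apply_eq_zero_of_forall_out (f : IndSpace σ) (h : ∀ q : G ⧸ H, f q.out = 0) (x : G) :
    f x = 0 := by
  rw [← norm_eq_zero, f.norm_apply_eq (y := (x : G ⧸ H).out) (by simp), h, norm_zero]

/-- Evaluation at a system of representatives of the left cosets. -/
def toLp (σ : H →* (F ≃ₗᵢ[ℂ] F)) : IndSpace σ →ₗ[ℂ] lp (fun _ : G ⧸ H => F) 2 where
  toFun f := ⟨fun q => f q.out, f.2.2⟩
  map_add' _ _ := rfl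
  map_smul' _ _ := rfl

theorem toLp_injective : Function.Injective (toLp σ) := by
  rw [injective_iff_map_eq_zero]
  intro f hf
  ext x
  exact f.apply_eq_zero_of_forall_out (fun q => congrFun (congrArg Subtype.val hf) q) x

/-- The norm is `‖f‖ = (∑ ‖f(t)‖²)^(1/2)`, summed over representatives `t` of left cosets. -/
instance : NormedAddCommGroup (IndSpace σ) :=
  NormedAddCommGroup.induced (IndSpace σ) (lp (fun _ : G ⧸ H => F) 2) (toLp σ) toLp_injective

instance : InnerProductSpace ℂ (IndSpace σ) where
  norm_smul_le c f := by
    change ‖toLp σ (c • f)‖ ≤ ‖c‖ * ‖toLp σ f‖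
    rw [map_smul, norm_smul]
  inner f f' := inner ℂ (toLp σ f) (toLp σ f')
  norm_sq_eq_re_inner f := norm_sq_eq_re_inner (𝕜 := ℂ) (toLp σ f)
  conj_inner_symm f f' := inner_conj_symm (𝕜 := ℂ) (toLp σ f) (toLp σ f')
  add_left f f' f'' := by rw [map_add, inner_add_left]
  smul_left f f' c := by rw [map_smul, inner_smul_left]

theorem norm_sq_eq (f : IndSpace σ) : ‖f‖ ^ 2 = ∑' q : G ⧸ H, ‖f q.out‖ ^ 2 := by
  have h := lp.norm_rpow_eq_tsum (p := 2) (by norm_num) (toLp σ f)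
  simp only [ENNReal.toReal_ofNat, Real.rpow_ofNat] at h
  exact h

theorem mk_inv_mul_out (g : G) (q : G ⧸ H) :
    (((g⁻¹ • q).out : G) : G ⧸ H) = ((g⁻¹ * q.out : G) : G ⧸ H) := by
  rw [QuotientGroup.out_eq', ← smul_eq_mul, ← MulAction.Quotient.smul_coe, QuotientGroup.out_eq']

/-- Left translation `(g · f)(x) = f(g⁻¹ x)`. -/
def translate (σ : H →* (F ≃ₗᵢ[ℂ] F)) (g : G) (f : IndSpace σ) : IndSpace σ :=
  ⟨fun x => f (g⁻¹ * x), fun x h => by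
    change f (g⁻¹ * (x * h)) = σ h⁻¹ (f (g⁻¹ * x))
    rw [← mul_assoc, f.apply_mul], by
    have h2 : 0 < (2 : ℝ≥0∞).toReal := by norm_num
    have h := (MulAction.toPerm (g⁻¹) : Equiv.Perm (G ⧸ H)).summable_iff.2
      ((memℓp_gen_iff h2).1 f.2.2)
    refine (memℓp_gen_iff h2).2 (h.congr fun q => ?_)
    exact congrArg (· ^ (2 : ℝ≥0∞).toReal) (f.norm_apply_eq (mk_inv_mul_out g q))⟩

theorem translate_apply (g : G) (f : IndSpace σ) (x : G) : translate σ g f x = f (g⁻¹ * x) := rfl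

theorem norm_translate (g : G) (f : IndSpace σ) : ‖translate σ g f‖ = ‖f‖ := by
  rw [← sq_eq_sq₀ (norm_nonneg _) (norm_nonneg _), norm_sq_eq, norm_sq_eq,
    ← (MulAction.toPerm (g⁻¹) : Equiv.Perm (G ⧸ H)).tsum_eq fun q => ‖f q.out‖ ^ 2]
  refine tsum_congr fun q => ?_
  rw [translate_apply, MulAction.toPerm_apply, f.norm_apply_eq (mk_inv_mul_out g q)]

end IndSpace

/-- The induced representation `Ind_H^G(σ)`, acting by `(g · f)(x) = f(g⁻¹ x)`. -/
def indRep (σ : H →* (F ≃ₗᵢ[ℂ] F)) : G →* (IndSpace σ ≃ₗᵢ[ℂ] IndSpace σ) where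
  toFun g :=
    { toFun := IndSpace.translate σ g
      invFun := IndSpace.translate σ g⁻¹
      map_add' := fun _ _ => rfl
      map_smul' := fun _ _ => rfl
      left_inv := fun f => by ext x; simp [IndSpace.translate_apply]
      right_inv := fun f => by ext x; simp [IndSpace.translate_apply]
      norm_map' := IndSpace.norm_translate g }
  map_one' := by
    ext f x
    change f (1⁻¹ * x) = f x
    simp
  map_mul' g h := by
    ext f x
    change f ((g * h)⁻¹ * x) = f (h⁻¹ * (g⁻¹ * x))
    rw [mul_inv_rev, mul_assoc]

end Ind

/-- `π` is unitarily equivalent to `Ind_H^G(σ)`, where `H = Comm_G(V)` is the commensurator of an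
open subgroup `V` of `G`, `H` is open and is its own commensurator, `V` is normal and of finite
index in `H`, and `σ` is an irreducible unitary representation of the finite group `H / V`, viewed
as a representation of `H`. -/
def IsInducedFromCommensurator {G : Type u} [Group G] [TopologicalSpace G]
    {E : Type v} [NormedAddCommGroup E] [InnerProductSpace ℂ E] (π : G →* (E ≃ₗᵢ[ℂ] E)) : Prop :=
  ∃ H V : Subgroup G,
    H = Subgroup.Commensurable.commensurator V ∧
    Subgroup.Commensurable.commensurator H = H ∧
    IsOpen (H : Set G) ∧ IsOpen (V : Set G) ∧ V ≤ H ∧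
    (V.subgroupOf H).FiniteIndex ∧
    ∃ (_ : (V.subgroupOf H).Normal)
      (F : Type v) (_ : NormedAddCommGroup F) (_ : InnerProductSpace ℂ F) (_ : CompleteSpace F)
      (σ : (H ⧸ V.subgroupOf H) →* (F ≃ₗᵢ[ℂ] F)),
      IsIrreducibleRep σ ∧
      AreUnitarilyEquivalent π (indRep (σ.comp (QuotientGroup.mk' (V.subgroupOf H))))

end

/-! ### Subgroups of permutation groups -/

section PermutationGroups

variable {G : Type*} [Group G] [TopologicalSpace G] {X : Type*} {ρ : G →* Equiv.Perm X}

/-! For an oligomorphic group, double cosets of the stabilizer of a tuple `x` correspond to orbits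
of the pairs `(x, g x)`, so there are finitely many of them.

Now let `π` be a non-zero continuous representation of a Roelcke precompact subgroup of `S_∞`. Small
open subgroups yield a non-zero vector `ξ` fixed by an open subgroup. Its matrix coefficient takes
finitely many values, and hence so do all inner products between points of the weak closure `Z` of
its orbit. Let `ζ` be a non-zero point of `Z` of least norm. By discreteness of the inner products,
a weak limit of distinct translates of `ζ` must be `0`; so `ζ` is orthogonal to each of its
translates that has an infinite orbit under the stabilizer `U` of `ζ`
(`IsContinuousRep.exists_vector_inner_eq_zero`).

Put `H = Comm(U)`. Roelcke precompactness makes `U` of finite index in `H`, so the span of `H ζ` is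
finite-dimensional, and it is orthogonal to its translates by elements outside `H`. An irreducible
`H`-subspace `M` of it is the inducing datum (`IsContinuousRep.exists_isInducingSubspace`). The
closed span of `G M` is the Hilbert sum of the translates of `M`, hence an induced representation
(`areUnitarilyEquivalent_indRep`), and it is irreducible because the projection onto any closed
invariant subspace of it maps `M` into `M` (`IsInducingSubspace.isMinimalInvariant`). So every
non-zero closed invariant subspace contains an irreducible one, and Zorn's lemma gives the
decomposition. -/

theorem Topology.IsInducing.exists_finite_forall_fixed_mem (hρ : IsInducing ρ) {U : Set G}
    (hU : U ∈ 𝓝 (1 : G)) : ∃ s : Set X, s.Finite ∧ ∀ g, (∀ x ∈ s, ρ g x = x) → g ∈ U := by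
  let _ : TopologicalSpace X := ⊥
  have : DiscreteTopology X := ⟨rfl⟩
  have hc : IsInducing (fun (g : G) (x : X) => ρ g x) := (IsInducing.mk rfl).comp hρ
  rw [hc.nhds_eq_comap, nhds_pi, Filter.mem_comap] at hU
  obtain ⟨t, ht, htU⟩ := hU
  obtain ⟨s, hs, u, hu, hut⟩ := Filter.mem_pi.1 ht
  refine ⟨s, hs, fun g hg => htU (hut fun x hx => ?_)⟩
  have := mem_of_mem_nhds (hu x)
  simpa [hg x hx] using this

theorem Topology.IsInducing.isOpen_setOf_fixed (hρ : IsInducing ρ) (x : X) :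
    IsOpen {g : G | ρ g x = x} := by
  let _ : TopologicalSpace X := ⊥
  have : DiscreteTopology X := ⟨rfl⟩
  have hc : IsInducing (fun (g : G) (x : X) => ρ g x) := (IsInducing.mk rfl).comp hρ
  have h : Continuous fun g : G => ρ g x := (continuous_apply x).comp hc.continuous
  exact (isOpen_discrete ({x} : Set X)).preimage h

/-- The pointwise stabilizer of a set under a permutation action. -/
def permFixator (ρ : G →* Equiv.Perm X) (s : Set X) : Subgroup G where
  carrier := {g | ∀ x ∈ s, ρ g x = x}
  one_mem' := by simp
  mul_mem' {a b} ha hb x hx := by simp [hb x hx, ha x hx]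
  inv_mem' {a} ha x hx := by rw [map_inv, Equiv.Perm.inv_eq_iff_eq, ha x hx]

theorem Topology.IsInducing.isOpen_permFixator (hρ : IsInducing ρ) {s : Set X} (hs : s.Finite) :
    IsOpen (permFixator ρ s : Set G) := by
  have : (permFixator ρ s : Set G) = ⋂ x ∈ s, {g | ρ g x = x} := by
    ext g; simp [permFixator]
  rw [this]
  exact hs.isOpen_biInter fun x _ => hρ.isOpen_setOf_fixed x

theorem IsSubgroupOfSInfty.exists_openSubgroup_subset (hG : IsSubgroupOfSInfty G) {U : Set G}
    (hU : U ∈ 𝓝 (1 : G)) : ∃ V : Subgroup G, IsOpen (V : Set G) ∧ (V : Set G) ⊆ U := by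
  obtain ⟨ρ, hρ⟩ := hG
  obtain ⟨s, hs, hsU⟩ := hρ.isInducing.exists_finite_forall_fixed_mem hU
  exact ⟨permFixator ρ s, hρ.isInducing.isOpen_permFixator hs, fun g hg => hsU g hg⟩

end PermutationGroups

/-! ### Oligomorphic groups -/

section Oligomorphic

/-- Transport of permutations along an injection, extending by the identity. -/
theorem isEmbedding_permExtend {X Y Z : Type*} (e : X ⊕ Y ≃ Z) :
    ∃ ρ : Equiv.Perm X →* Equiv.Perm Z, Topology.IsEmbedding ρ := by
  let ρ : Equiv.Perm X →* Equiv.Perm Z :=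
    { toFun := fun g => e.permCongr (Equiv.sumCongr g 1)
      map_one' := by ext z; simp
      map_mul' := fun g h => by
        ext z
        obtain ⟨z, rfl⟩ := e.surjective z
        rcases z with x | y <;> simp }
  have hl : ∀ g x, ρ g (e (Sum.inl x)) = e (Sum.inl (g x)) := fun g x => by simp [ρ]
  have hr : ∀ g y, ρ g (e (Sum.inr y)) = e (Sum.inr y) := fun g y => by simp [ρ]
  let _ : TopologicalSpace X := ⊥
  have : DiscreteTopology X := ⟨rfl⟩
  let _ : TopologicalSpace Z := ⊥
  have : DiscreteTopology Z := ⟨rfl⟩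
  have hX : Topology.IsInducing (fun (g : Equiv.Perm X) (x : X) => g x) := ⟨rfl⟩
  have hZ : Topology.IsInducing (fun (g : Equiv.Perm Z) (x : Z) => g x) := ⟨rfl⟩
  refine ⟨ρ, ⟨⟨le_antisymm ?_ ?_⟩, fun g h hgh => ?_⟩⟩
  · rw [← continuous_iff_le_induced, hZ.continuous_iff]
    refine continuous_pi fun z => ?_
    obtain ⟨z, rfl⟩ := e.surjective z
    rcases z with x | y
    · change Continuous fun g => ρ g (e (Sum.inl x))
      simp only [hl]
      exact (continuous_of_discreteTopology (f := fun x => e (Sum.inl x))).comp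
        ((continuous_apply x).comp hX.continuous)
    · change Continuous fun g => ρ g (e (Sum.inr y))
      simp only [hr]
      exact continuous_const
  · rw [← continuous_id_iff_le]
    -- With the pulled back topology as the instance, what remains is continuity of the evaluations
    -- `g ↦ g x`, which are read off from `ρ g` at `e (Sum.inl x)`.
    let _ : TopologicalSpace (Equiv.Perm X) := TopologicalSpace.induced ρ (permTopology Z)
    rw [continuous_def]
    intro s hs
    obtain ⟨t, ht, rfl⟩ := hs
    have h : Continuous fun (g : Equiv.Perm X) (x : X) => g x := by
      refine continuous_pi fun x => ?_
      have h1 : Continuous fun g : Equiv.Perm X => ρ g (e (Sum.inl x)) :=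
        (continuous_apply (e (Sum.inl x))).comp (hZ.continuous.comp continuous_induced_dom)
      refine continuous_discrete_rng.2 fun y => ?_
      have : (fun g : Equiv.Perm X => g x) ⁻¹' {y} =
          (fun g : Equiv.Perm X => ρ g (e (Sum.inl x))) ⁻¹' {e (Sum.inl y)} := by
        ext g; simp [hl]
      rw [this]
      exact (isOpen_discrete _).preimage h1
    exact ht.preimage h
  · ext x
    have := congrArg (fun p : Equiv.Perm Z => p (e (Sum.inl x))) hgh
    simpa [hl] using this

variable {G : Type*} [Group G] [TopologicalSpace G]

theorem IsOligomorphic.isSubgroupOfSInfty (hG : IsOligomorphic G) : IsSubgroupOfSInfty G := by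
  obtain ⟨X, hX, ρ, hρ, -⟩ := hG
  -- The summand `ℕ` covers the case of a finite `X`.
  obtain ⟨e⟩ := nonempty_equiv_of_countable (α := X ⊕ ℕ) (β := ℕ)
  obtain ⟨τ, hτ⟩ := isEmbedding_permExtend e
  exact ⟨τ.comp ρ, hτ.comp hρ⟩

theorem IsOligomorphic.isRoelckePrecompact (hG : IsOligomorphic G) : IsRoelckePrecompact G := by
  obtain ⟨X, hX, ρ, hρ, hfin⟩ := hG
  intro U hU
  obtain ⟨s, hs, hsU⟩ := hρ.isInducing.exists_finite_forall_fixed_mem hU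
  obtain ⟨n, x, -, rfl⟩ := hs.fin_param
  -- If `h` carries `(x, f x)` to `(x, g x)`, then `h` and `(h f)⁻¹ g` both fix `x`, so `g` lies in
  -- the double coset of `f`. Thus one `f` for each orbit of pairs suffices.
  let pair : G → Fin (n + n) → X := fun g => Fin.append x fun i => ρ g (x i)
  let orb : G → Set (Fin (n + n) → X) := fun g => Set.range fun (h : G) i => ρ h (pair g i)
  have horb : (Set.range orb).Finite :=
    (hfin (n + n)).subset (by rintro _ ⟨g, rfl⟩; exact ⟨pair g, rfl⟩)
  obtain ⟨F, hF, hFr⟩ : ∃ F : Set G, F.Finite ∧ orb '' F = Set.range orb := by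
    obtain ⟨F, -, hF⟩ := Set.exists_subset_bijOn Set.univ orb
    rw [Set.image_univ] at hF
    exact ⟨F, hF.finite_iff_finite.2 horb, hF.image_eq⟩
  refine ⟨F, hF, Set.eq_univ_of_forall fun g => ?_⟩
  obtain ⟨f, hf, hfg⟩ : orb g ∈ orb '' F := hFr ▸ ⟨g, rfl⟩
  have hg : pair g ∈ orb f := hfg ▸ ⟨1, by simp⟩
  obtain ⟨h, hh⟩ := hg
  have h1 : ∀ i, ρ h (x i) = x i := fun i => by
    simpa [pair] using congrFun hh (Fin.castAdd n i)
  have h2 : ∀ i, ρ h (ρ f (x i)) = ρ g (x i) := fun i => by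
    have := congrFun hh (Fin.natAdd n i)
    simp only [pair, Fin.append_right] at this
    exact this
  refine ⟨h * f, ⟨h, hsU h ?_, f, hf, rfl⟩, (h * f)⁻¹ * g, hsU _ ?_, mul_inv_cancel_left _ _⟩
  · rintro _ ⟨i, rfl⟩
    exact h1 i
  · rintro _ ⟨i, rfl⟩
    rw [map_mul, Equiv.Perm.mul_apply, ← h2, map_inv, Equiv.Perm.inv_eq_iff_eq, map_mul]
    rfl

end Oligomorphic

/-! ### Vectors fixed by open subgroups -/

section FixedVectors

variable {G : Type*} [Group G] {E : Type*} [NormedAddCommGroup E] [InnerProductSpace ℂ E]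
  {π : G →* (E ≃ₗᵢ[ℂ] E)}

theorem rep_mul_apply (π : G →* (E ≃ₗᵢ[ℂ] E)) (g h : G) (x : E) : π (g * h) x = π g (π h x) := by
  rw [map_mul]; rfl

theorem rep_inv_apply_self (π : G →* (E ≃ₗᵢ[ℂ] E)) (g : G) (x : E) : π g⁻¹ (π g x) = x := by
  rw [← rep_mul_apply]; simp

theorem rep_apply_inv_self (π : G →* (E ≃ₗᵢ[ℂ] E)) (g : G) (x : E) : π g (π g⁻¹ x) = x := by
  rw [← rep_mul_apply]; simp

theorem inner_rep_left (π : G →* (E ≃ₗᵢ[ℂ] E)) (g : G) (x y : E) :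
    inner ℂ (π g x) y = inner ℂ x (π g⁻¹ y) := by
  rw [← (π g).inner_map_map x, rep_apply_inv_self]

/-- Expanding the square gives `‖x - y‖² = ‖x‖² - ‖y‖² ≤ 0`. This turns equalities of inner products
into equalities of vectors. -/
theorem eq_of_inner_eq_of_norm_le {x y : E} (h : inner ℂ x y = inner ℂ y y) (hn : ‖x‖ ≤ ‖y‖) :
    x = y := by
  have h1 := norm_sub_sq (𝕜 := ℂ) x y
  rw [h, ← norm_sq_eq_re_inner] at h1
  have h2 : ‖x‖ ^ 2 ≤ ‖y‖ ^ 2 := by gcongr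
  have h3 : ‖x - y‖ ^ 2 = 0 := le_antisymm (by linarith) (by positivity)
  exact sub_eq_zero.1 (norm_eq_zero.1 (pow_eq_zero_iff two_ne_zero |>.1 h3))

/-- Adding the variational inequalities for two points nearest to `0` gives `‖b - a‖² ≤ 0`. By
uniqueness, isometries fixing `0` and preserving `C` fix the minimizer. -/
theorem Convex.exists_unique_norm_min {F : Type*} [NormedAddCommGroup F] [InnerProductSpace ℝ F]
    {C : Set F} (hne : C.Nonempty) (hC : IsComplete C) (hconv : Convex ℝ C) :
    ∃ a ∈ C, ∀ b ∈ C, ‖b‖ = ‖a‖ → b = a := by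
  obtain ⟨a, haC, ha⟩ := exists_norm_eq_iInf_of_complete_convex hne hC hconv 0
  refine ⟨a, haC, fun b hbC hba => ?_⟩
  have hb : ‖(0 : F) - b‖ = ⨅ w : C, ‖(0 : F) - w‖ := by
    rw [← ha]; simpa using hba
  have h1 := (norm_eq_iInf_iff_real_inner_le_zero hconv haC).1 ha _ hbC
  have h2 := (norm_eq_iInf_iff_real_inner_le_zero hconv hbC).1 hb _ haC
  have h3 : inner ℝ (b - a) (b - a) ≤ 0 := by
    simp only [zero_sub, inner_neg_left, inner_sub_left, inner_sub_right] at h1 h2 ⊢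
    linarith
  rw [real_inner_self_eq_norm_sq] at h3
  exact sub_eq_zero.1 (norm_eq_zero.1 (pow_eq_zero_iff two_ne_zero |>.1
    (le_antisymm h3 (sq_nonneg _))))

/-- A vector that a subgroup moves by less than its norm yields a non-zero fixed vector, namely the
vector of smallest norm in the closed convex hull of the orbit. -/
theorem exists_fixed_of_norm_sub_le [CompleteSpace E] (π : G →* (E ≃ₗᵢ[ℂ] E)) {V : Subgroup G}
    {ξ : E} {r : ℝ} (hr : r < ‖ξ‖) (hξ : ∀ v ∈ V, ‖π v ξ - ξ‖ ≤ r) :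
    ∃ η : E, η ≠ 0 ∧ ∀ v ∈ V, π v η = η := by
  set O : Set E := {x | ∃ v ∈ V, x = π v ξ} with hO
  set C : Set E := closure (convexHull ℝ O) with hC
  have hCc : Convex ℝ C := (convex_convexHull ℝ O).closure
  have hOC : O ⊆ C := (subset_convexHull ℝ O).trans subset_closure
  have hmin : ∀ D : Set E, Convex ℝ D → IsClosed D → O ⊆ D → C ⊆ D := fun D h1 h2 h3 =>
    closure_minimal (convexHull_min h3 h1) h2
  have hne : C.Nonempty := ⟨ξ, hOC ⟨1, V.one_mem, by simp⟩⟩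
  have hball : C ⊆ Metric.closedBall ξ r := by
    refine hmin _ (convex_closedBall ξ r) Metric.isClosed_closedBall ?_
    rintro _ ⟨v, hv, rfl⟩
    simpa [dist_eq_norm] using hξ v hv
  obtain ⟨a, haC, ha⟩ := letI := InnerProductSpace.rclikeToReal ℂ E
    Convex.exists_unique_norm_min hne isClosed_closure.isComplete hCc
  have hinv : ∀ v ∈ V, C ⊆ (π v) ⁻¹' C := fun v hv => by
    refine hmin _ ?_ (isClosed_closure.preimage (π v).continuous) ?_
    · exact hCc.linear_preimage ((π v).toLinearEquiv.toLinearMap.restrictScalars ℝ)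
    · rintro _ ⟨w, hw, rfl⟩
      exact hOC ⟨v * w, V.mul_mem hv hw, (rep_mul_apply π v w ξ).symm⟩
  refine ⟨a, ?_, fun v hv => ?_⟩
  · rintro rfl
    have := hball haC
    rw [Metric.mem_closedBall, dist_zero_left] at this
    linarith
  · exact ha _ (hinv v hv haC) (by simp)

theorem IsContinuousRep.exists_fixed_vector [TopologicalSpace G] [CompleteSpace E] [Nontrivial E]
    (hG : IsSubgroupOfSInfty G) (hπ : IsContinuousRep π) :
    ∃ V : Subgroup G, IsOpen (V : Set G) ∧ ∃ ξ : E, ξ ≠ 0 ∧ ∀ v ∈ V, π v ξ = ξ := by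
  obtain ⟨ξ, hξ⟩ := exists_ne (0 : E)
  have hpos : 0 < ‖ξ‖ := norm_pos_iff.2 hξ
  have hU : {g : G | ‖π g ξ - ξ‖ < ‖ξ‖ / 2} ∈ 𝓝 (1 : G) := by
    have hc : Continuous fun g : G => ‖π g ξ - ξ‖ := ((hπ ξ).sub continuous_const).norm
    exact (isOpen_lt hc continuous_const).mem_nhds (by simpa using hpos)
  obtain ⟨V, hVo, hV⟩ := hG.exists_openSubgroup_subset hU
  exact ⟨V, hVo, exists_fixed_of_norm_sub_le π (half_lt_self hpos) fun v hv => (hV hv).le⟩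

/-- The coefficient is constant on the double cosets of `V`, and Roelcke precompactness makes these
finite in number. -/
theorem IsRoelckePrecompact.finite_range_inner [TopologicalSpace G] (hG : IsRoelckePrecompact G)
    {V : Subgroup G} (hV : IsOpen (V : Set G)) {ξ : E} (hξ : ∀ v ∈ V, π v ξ = ξ) :
    (Set.range fun g => inner ℂ (π g ξ) ξ).Finite := by
  obtain ⟨F, hF, hGF⟩ := hG V (hV.mem_nhds V.one_mem)
  refine (hF.image fun g => inner ℂ (π g ξ) ξ).subset ?_
  rintro _ ⟨g, rfl⟩
  obtain ⟨_, ⟨a, ha, f, hf, rfl⟩, b, hb, rfl⟩ : g ∈ (V : Set G) * F * V := hGF ▸ Set.mem_univ g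
  refine ⟨f, hf, ?_⟩
  simp only [rep_mul_apply]
  rw [hξ b hb, inner_rep_left π a, hξ _ (V.inv_mem ha)]

end FixedVectors

/-! ### The weak closure of an orbit -/

section WeakClosure

variable {G : Type*} [Group G] {E : Type*} [NormedAddCommGroup E] [InnerProductSpace ℂ E]
  {π : G →* (E ≃ₗᵢ[ℂ] E)} {ξ : E}

/-- The weak closure of the orbit of `ξ`. -/
def weakOrbitClosure (π : G →* (E ≃ₗᵢ[ℂ] E)) (ξ : E) : Set E :=
  {η | (fun y => inner ℂ η y) ∈ closure (Set.range fun (g : G) (y : E) => inner ℂ (π g ξ) y)}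

theorem self_mem_weakOrbitClosure : ξ ∈ weakOrbitClosure π ξ :=
  subset_closure ⟨1, by simp⟩

theorem rep_mem_weakOrbitClosure {η : E} (hη : η ∈ weakOrbitClosure π ξ) (g : G) :
    π g η ∈ weakOrbitClosure π ξ := by
  let T : (E → ℂ) → E → ℂ := fun f y => f (π g⁻¹ y)
  have hT : Continuous T := continuous_pi fun y => continuous_apply _
  have := map_mem_closure hT hη (t := Set.range fun (g : G) (y : E) => inner ℂ (π g ξ) y) ?_
  · have h : T (fun y => inner ℂ η y) = fun y => inner ℂ (π g η) y :=
      funext fun y => (inner_rep_left π g η y).symm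
    rwa [h] at this
  · rintro _ ⟨h, rfl⟩
    refine ⟨g * h, funext fun y => ?_⟩
    simp only [T, rep_mul_apply, inner_rep_left π g]

/-- The inner product is only separately weakly continuous, so the limit is taken in one variable at
a time: `h1` against orbit points, then `h2` in the other variable. -/
theorem inner_mem_of_mem_weakOrbitClosure {F : Set ℂ} (hF : IsClosed F)
    (hξ : ∀ g, inner ℂ (π g ξ) ξ ∈ F) {η η' : E} (hη : η ∈ weakOrbitClosure π ξ)
    (hη' : η' ∈ weakOrbitClosure π ξ) : inner ℂ η η' ∈ F := by
  have h1 : ∀ h : G, inner ℂ η (π h ξ) ∈ F := fun h => by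
    refine closure_minimal (t := {f : E → ℂ | f (π h ξ) ∈ F}) ?_
      (hF.preimage (continuous_apply _)) hη
    rintro _ ⟨g, rfl⟩
    have : inner ℂ (π g ξ) (π h ξ) = inner ℂ (π (h⁻¹ * g) ξ) ξ := by
      rw [rep_mul_apply, inner_rep_left π h⁻¹, inv_inv]
    simpa only [Set.mem_ofPred_eq, this] using hξ _
  have h2 := closure_minimal (t := {f : E → ℂ | (starRingEnd ℂ) (f η) ∈ F}) ?_
      (hF.preimage (Complex.continuous_conj.comp (continuous_apply _))) hη'
  · simpa only [Set.mem_ofPred_eq, inner_conj_symm] using h2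
  · rintro _ ⟨g, rfl⟩
    simpa only [Set.mem_ofPred_eq, inner_conj_symm] using h1 g

theorem mem_weakOrbitClosure_of_tendsto {l : Filter E} [l.NeBot]
    (hl : ∀ᶠ x in l, x ∈ weakOrbitClosure π ξ) {η : E}
    (h : ∀ y, Filter.Tendsto (fun x => inner ℂ x y) l (𝓝 (inner ℂ η y))) :
    η ∈ weakOrbitClosure π ξ := by
  change (fun y => inner ℂ η y) ∈ closure _
  exact isClosed_closure.mem_of_tendsto (tendsto_pi_nhds.2 h) hl

/-- Banach–Alaoglu, transported to `E` by the Riesz representation. -/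
theorem Ultrafilter.exists_tendsto_inner [CompleteSpace E] (𝒰 : Ultrafilter E) {r : ℝ}
    (h𝒰 : ∀ᶠ x in (𝒰 : Filter E), ‖x‖ ≤ r) :
    ∃ η : E, ∀ y, Filter.Tendsto (fun x => inner ℂ x y) 𝒰 (𝓝 (inner ℂ η y)) := by
  let D : E → WeakDual ℂ E := fun x => StrongDual.toWeakDual (InnerProductSpace.toDual ℂ E x)
  obtain ⟨φ, -, hφ⟩ := (WeakDual.isCompact_closedBall (𝕜 := ℂ) (E := E) 0 r).ultrafilter_le_nhds
    (𝒰.map D) (by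
      rw [Filter.le_principal_iff]
      change ∀ᶠ x in (𝒰 : Filter E), _
      filter_upwards [h𝒰] with x hx
      simpa [D] using hx)
  refine ⟨(InnerProductSpace.toDual ℂ E).symm (WeakDual.toStrongDual φ), fun y => ?_⟩
  have h : Filter.Tendsto D 𝒰 (𝓝 φ) := hφ
  have := ((WeakDual.eval_continuous y).tendsto φ).comp h
  rw [InnerProductSpace.toDual_symm_apply]
  exact this

/-- There is a vector with open stabilizer that is orthogonal to all its translates
having an infinite orbit under the stabilizer. -/
theorem IsContinuousRep.exists_vector_inner_eq_zero [TopologicalSpace G] [CompleteSpace E]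
    [Nontrivial E] (hG : IsSubgroupOfSInfty G) (hR : IsRoelckePrecompact G)
    (hπ : IsContinuousRep π) :
    ∃ ζ : E, ζ ≠ 0 ∧ IsOpen {g | π g ζ = ζ} ∧
      ∀ g, {x | ∃ u, π u ζ = ζ ∧ π u (π g ζ) = x}.Infinite → inner ℂ (π g ζ) ζ = 0 := by
  obtain ⟨V, hV, ξ, hξ0, hξ⟩ := hπ.exists_fixed_vector hG
  set F := Set.range fun g => inner ℂ (π g ξ) ξ with hFdef
  have hF : F.Finite := hR.finite_range_inner hV hξ
  set Z := weakOrbitClosure π ξ with hZ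
  have hZF : ∀ {η η' : E}, η ∈ Z → η' ∈ Z → inner ℂ η η' ∈ F := fun h h' =>
    inner_mem_of_mem_weakOrbitClosure hF.isClosed (fun g => ⟨g, rfl⟩) h h'
  -- A least non-zero norm exists because the squared norms of points of `Z` lie in the finite set
  -- `F`.
  obtain ⟨_, ⟨ζ, ⟨hζZ, hζ0⟩, rfl⟩, hζmin⟩ : ∃ a ∈ norm '' {η | η ∈ Z ∧ η ≠ 0},
      ∀ b ∈ norm '' {η | η ∈ Z ∧ η ≠ 0}, id a ≤ id b := by
    refine Set.exists_min_image _ id ((hF.image fun z : ℂ => √(RCLike.re z)).subset ?_)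
      ⟨_, ξ, ⟨self_mem_weakOrbitClosure, hξ0⟩, rfl⟩
    rintro _ ⟨η, ⟨hη, -⟩, rfl⟩
    exact ⟨_, hZF hη hη, (norm_eq_sqrt_re_inner (𝕜 := ℂ) η).symm⟩
  refine ⟨ζ, hζ0, ?_, fun g hg => ?_⟩
  · have hc : Continuous fun g => inner ℂ (π g ζ) ζ := (hπ ζ).inner continuous_const
    -- The coefficient of `ζ` has values in the finite set `F`, so its level sets are open; the
    -- level of `inner ℂ ζ ζ` is the stabilizer.
    have : {g | π g ζ = ζ} = (fun g => inner ℂ (π g ζ) ζ) ⁻¹' (F \ {inner ℂ ζ ζ})ᶜ := by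
      ext g
      simp only [Set.mem_ofPred_eq, Set.mem_preimage, Set.mem_compl_iff, Set.mem_sdiff,
        Set.mem_singleton_iff, not_and, not_not]
      refine ⟨fun h _ => by rw [h], fun h => eq_of_inner_eq_of_norm_le
        (h (hZF (rep_mem_weakOrbitClosure hζZ g) hζZ)) (by simp)⟩
    rw [this]
    exact hF.sdiff.isClosed.isOpen_compl.preimage hc
  · set A := {x | ∃ u, π u ζ = ζ ∧ π u (π g ζ) = x} with hA
    have hAZ : ∀ x ∈ A, x ∈ Z := by
      rintro _ ⟨u, -, rfl⟩
      exact rep_mem_weakOrbitClosure (rep_mem_weakOrbitClosure hζZ g) u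
    have hAn : ∀ x ∈ A, ‖x‖ = ‖ζ‖ := by
      rintro _ ⟨u, -, rfl⟩
      simp
    have hAi : ∀ x ∈ A, inner ℂ x ζ = inner ℂ (π g ζ) ζ := by
      rintro _ ⟨u, hu, rfl⟩
      rw [inner_rep_left π u, show π u⁻¹ ζ = ζ by rw [← hu, rep_inv_apply_self, hu]]
    have := hg.cofinite_inf_principal_neBot
    -- A non-principal ultrafilter on the infinite orbit `A`. Since `inner ℂ x ζ` is constant on
    -- `A`, it is enough that the weak limit along `𝒰` be zero.
    let 𝒰 : Ultrafilter E := Ultrafilter.of (Filter.cofinite ⊓ Filter.principal A)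
    have hle : (𝒰 : Filter E) ≤ Filter.cofinite ⊓ Filter.principal A := Ultrafilter.of_le _
    have hUA : ∀ᶠ x in (𝒰 : Filter E), x ∈ A := (hle.trans inf_le_right) (Filter.mem_principal_self A)
    obtain ⟨η, hη⟩ := 𝒰.exists_tendsto_inner (hUA.mono fun x hx => (hAn x hx).le)
    have hηZ : η ∈ Z := mem_weakOrbitClosure_of_tendsto (hUA.mono hAZ) hη
    have hη0 : η = 0 := by
      by_contra hne
      -- Convergence within the finite set `F` is eventual equality. With `‖x‖ = ‖ζ‖ ≤ ‖η‖`, from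
      -- the minimality of `ζ`, this forces `x = η` eventually, against non-principality.
      have h1 : ∀ᶠ x in (𝒰 : Filter E), inner ℂ x η = inner ℂ η η := by
        have ho : (F \ {inner ℂ η η})ᶜ ∈ 𝓝 (inner ℂ η η) :=
          hF.sdiff.isClosed.isOpen_compl.mem_nhds (by simp)
        filter_upwards [hη η ho, hUA] with x hx hxA
        by_contra hn
        exact hx ⟨hZF (hAZ x hxA) hηZ, hn⟩
      have h2 : ∀ᶠ x in (𝒰 : Filter E), x = η := by
        filter_upwards [h1, hUA] with x hx hxA
        refine eq_of_inner_eq_of_norm_le hx ?_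
        rw [hAn x hxA]
        exact hζmin _ ⟨η, ⟨hηZ, hne⟩, rfl⟩
      have h3 : ∀ᶠ x in (𝒰 : Filter E), x ≠ η :=
        (hle.trans inf_le_left) (Set.finite_singleton η).compl_mem_cofinite
      obtain ⟨x, hx, hx'⟩ := (h2.and h3).exists
      exact hx' hx
    have h4 : Filter.Tendsto (fun x => inner ℂ x ζ) 𝒰 (𝓝 (inner ℂ (π g ζ) ζ)) :=
      tendsto_const_nhds.congr' (hUA.mono fun x hx => (hAi x hx).symm)
    simpa [hη0] using tendsto_nhds_unique h4 (hη ζ)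

end WeakClosure

/-! ### Commensurators in Roelcke precompact groups -/

section Commensurators

open Subgroup Commensurable

variable {G : Type*} [Group G]

/-- Orbit–stabilizer: the stabilizer of `gH` in `W` is `W ∩ gHg⁻¹`. -/
theorem finite_orbit_quotient_iff (W H : Subgroup G) (g : G) :
    (MulAction.orbit W (g : G ⧸ H)).Finite ↔ (ConjAct.toConjAct g • H).relIndex W ≠ 0 := by
  have h : (ConjAct.toConjAct g • H).subgroupOf W = MulAction.stabilizer W (g : G ⧸ H) := by
    ext w
    rw [mem_subgroupOf, mem_pointwise_smul_iff_inv_smul_mem, MulAction.mem_stabilizer_iff, eq_comm,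
      ← ConjAct.toConjAct_inv, ConjAct.toConjAct_smul, inv_inv]
    change _ ↔ (g : G ⧸ H) = ((w * g : G) : G ⧸ H)
    rw [QuotientGroup.eq, mul_assoc]
  rw [relIndex, h, MulAction.index_stabilizer]
  exact ⟨fun hf => Set.ncard_ne_zero_of_mem (MulAction.mem_orbit_self _) hf,
    Set.finite_of_ncard_ne_zero⟩

theorem le_commensurator (U : Subgroup G) : U ≤ commensurator U := fun u hu => by
  have : ConjAct.toConjAct u • U = U := by
    ext x
    rw [mem_pointwise_smul_iff_inv_smul_mem, ← ConjAct.toConjAct_inv, ConjAct.toConjAct_smul,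
      inv_inv, U.mul_mem_cancel_right hu, U.mul_mem_cancel_left (inv_mem hu)]
  rw [commensurator_mem_iff, this]

/-- Two finite orbits would make `H ∩ gHg⁻¹` and `H ∩ g⁻¹Hg` of finite index in `H`; conjugating the
latter by `g` puts `g` in the commensurator. -/
theorem infinite_orbit_or_infinite_orbit {V H : Subgroup G} (hVH : V.relIndex H ≠ 0) {g : G}
    (hg : g ∉ commensurator H) : (MulAction.orbit V (g : G ⧸ H)).Infinite ∨
      (MulAction.orbit V ((g⁻¹ : G) : G ⧸ H)).Infinite := by
  by_contra! h
  simp only [finite_orbit_quotient_iff] at h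
  refine hg ⟨relIndex_ne_zero_trans h.1 hVH, ?_⟩
  have h2 := relIndex_ne_zero_trans h.2 hVH
  rwa [← relIndex_pointwise_smul (ConjAct.toConjAct g), ConjAct.toConjAct_inv,
    smul_inv_smul] at h2

variable [TopologicalSpace G]

/-- If `g = a f b` with `a, b ∈ U` commensurates `U`, then so does `f`, and `gU` lies in the
`U`-orbit of `fU`, which is finite. Only finitely many `f` are needed. -/
theorem IsRoelckePrecompact.finite_orbit_commensurator (hR : IsRoelckePrecompact G)
    {U : Subgroup G} (hU : IsOpen (U : Set G)) :
    (MulAction.orbit (commensurator U) ((1 : G) : G ⧸ U)).Finite := by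
  obtain ⟨F, hF, hGF⟩ := hR U (hU.mem_nhds U.one_mem)
  have hUC := le_commensurator U
  refine ((hF.inter_of_left (commensurator U : Set G)).biUnion
    (t := fun f => MulAction.orbit U (f : G ⧸ U)) fun f hf => ?_).subset ?_
  · exact (finite_orbit_quotient_iff U U f).2 hf.2.1
  · rintro _ ⟨⟨g, hg⟩, rfl⟩
    obtain ⟨_, ⟨a, ha, f, hf, rfl⟩, b, hb, rfl⟩ : g ∈ (U : Set G) * F * U := hGF ▸ Set.mem_univ g
    refine Set.mem_biUnion (x := f) ⟨hf, ?_⟩ ⟨⟨a, ha⟩, ?_⟩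
    · have := mul_mem (mul_mem (inv_mem (hUC ha)) hg) (inv_mem (hUC hb))
      simpa [mul_assoc] using this
    · change ((a * f : G) : G ⧸ U) = ((a * f * b * 1 : G) : G ⧸ U)
      rw [QuotientGroup.eq]
      simpa [mul_assoc] using hb

theorem IsRoelckePrecompact.commensurable_commensurator (hR : IsRoelckePrecompact G)
    {U : Subgroup G} (hU : IsOpen (U : Set G)) : Commensurable U (commensurator U) := by
  have hUC := le_commensurator U
  refine ⟨?_, by simp [relIndex_eq_one.2 hUC]⟩
  simpa using (finite_orbit_quotient_iff _ _ _).1 (hR.finite_orbit_commensurator hU)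

end Commensurators

/-! ### Subspaces from which a representation is induced -/

section InducingSubspace

open Subgroup Commensurable

variable {G : Type*} [Group G] {E : Type*} [NormedAddCommGroup E] [InnerProductSpace ℂ E]
  {π : G →* (E ≃ₗᵢ[ℂ] E)}

/-- The stabilizer of a vector. -/
def vectorStabilizer (π : G →* (E ≃ₗᵢ[ℂ] E)) (x : E) : Subgroup G where
  carrier := {g | π g x = x}
  one_mem' := by simp
  mul_mem' {a b} ha hb := by
    change π (a * b) x = x
    rw [rep_mul_apply, show π b x = x from hb, show π a x = x from ha]
  inv_mem' {a} ha := by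
    change π a⁻¹ x = x
    rw [← show π a x = x from ha, rep_inv_apply_self, ha]

theorem mem_vectorStabilizer {g : G} {x : E} : g ∈ vectorStabilizer π x ↔ π g x = x := Iff.rfl

theorem vectorStabilizer_rep (h : G) (x : E) :
    vectorStabilizer π (π h x) = ConjAct.toConjAct h • vectorStabilizer π x := by
  ext g
  rw [mem_pointwise_smul_iff_inv_smul_mem, ← ConjAct.toConjAct_inv, ConjAct.toConjAct_smul, inv_inv,
    mem_vectorStabilizer, mem_vectorStabilizer, rep_mul_apply, rep_mul_apply]
  exact ⟨fun hg => by rw [hg, rep_inv_apply_self], fun hg => by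
    conv_rhs => rw [← hg]
    rw [rep_apply_inv_self]⟩

theorem isOpen_vectorStabilizer_rep [TopologicalSpace G] [IsTopologicalGroup G] {x : E}
    (hx : IsOpen (vectorStabilizer π x : Set G)) (h : G) :
    IsOpen (vectorStabilizer π (π h x) : Set G) := by
  have : (vectorStabilizer π (π h x) : Set G) =
      (fun g => h⁻¹ * g * h) ⁻¹' (vectorStabilizer π x : Set G) := by
    ext g
    rw [vectorStabilizer_rep, SetLike.mem_coe, mem_pointwise_smul_iff_inv_smul_mem,
      ← ConjAct.toConjAct_inv, ConjAct.toConjAct_smul, inv_inv]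
    rfl
  rw [this]
  exact hx.preimage (by fun_prop)

theorem rep_eq_rep_iff {x : E} {a b : G} :
    π a x = π b x ↔ (a : G ⧸ vectorStabilizer π x) = b := by
  rw [QuotientGroup.eq, mem_vectorStabilizer, rep_mul_apply]
  exact ⟨fun h => by rw [← h, rep_inv_apply_self], fun h => by rw [← rep_apply_inv_self π a (π b x), h]⟩

/-- Identifies orbits of vectors with orbits of cosets, so that their finiteness becomes a question
about indices. -/
theorem setOf_rep_eq_image {x : E} (W : Subgroup G) (g : G) :
    {y | ∃ u ∈ W, π u (π g x) = y} = (fun q : G ⧸ vectorStabilizer π x => π q.out x) ''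
      MulAction.orbit W (g : G ⧸ vectorStabilizer π x) := by
  have h : ∀ a : G, π (a : G ⧸ vectorStabilizer π x).out x = π a x := fun a =>
    rep_eq_rep_iff.2 (QuotientGroup.out_eq' _)
  ext y
  constructor
  · rintro ⟨u, hu, rfl⟩
    exact ⟨_, ⟨⟨u, hu⟩, rfl⟩, (h (u * g)).trans (rep_mul_apply π u g x)⟩
  · rintro ⟨_, ⟨u, rfl⟩, rfl⟩
    exact ⟨u, u.2, ((h (u * g)).trans (rep_mul_apply π u g x)).symm⟩

theorem injective_rep_out (x : E) :
    Function.Injective fun q : G ⧸ vectorStabilizer π x => π q.out x := fun p q h => by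
  simpa using rep_eq_rep_iff.1 h

/-- A finite-dimensional subspace `M` carrying an irreducible representation of a
self-commensurating open subgroup `H`, with an open normal subgroup `V` of finite index in `H`
acting trivially, such that `M` is orthogonal to its translates by elements outside `H`. -/
structure IsInducingSubspace [TopologicalSpace G] (π : G →* (E ≃ₗᵢ[ℂ] E)) (H V : Subgroup G)
    (M : Submodule ℂ E) : Prop where
  eq_commensurator : H = commensurator V
  commensurator_eq : commensurator H = H
  isOpen_left : IsOpen (H : Set G)
  isOpen_right : IsOpen (V : Set G)
  le : V ≤ H
  finiteIndex : (V.subgroupOf H).FiniteIndex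
  normal : (V.subgroupOf H).Normal
  finiteDimensional : FiniteDimensional ℂ M
  ne_bot : M ≠ ⊥
  rep_mem : ∀ h ∈ H, ∀ m ∈ M, π h m ∈ M
  rep_eq : ∀ v ∈ V, ∀ m ∈ M, π v m = m
  eq_bot_or_eq : ∀ L ≤ M, (∀ h ∈ H, ∀ x ∈ L, π h x ∈ L) → L = ⊥ ∨ L = M
  inner_eq_zero : ∀ g ∉ H, ∀ m ∈ M, ∀ m' ∈ M, inner ℂ (π g m) m' = 0

/-- A non-zero invariant subspace of least dimension works. -/
theorem exists_minimal_invariant_le {M : Submodule ℂ E} [FiniteDimensional ℂ M] (hM : M ≠ ⊥)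
    {H : Subgroup G} (hH : ∀ h ∈ H, ∀ m ∈ M, π h m ∈ M) :
    ∃ N ≤ M, N ≠ ⊥ ∧ (∀ h ∈ H, ∀ m ∈ N, π h m ∈ N) ∧
      ∀ L ≤ N, (∀ h ∈ H, ∀ x ∈ L, π h x ∈ L) → L = ⊥ ∨ L = N := by
  obtain ⟨N, ⟨hNM, hN0, hNH⟩, hmin⟩ :=
    (measure fun L : Submodule ℂ E => Module.finrank ℂ L).wf.has_min
      {L | L ≤ M ∧ L ≠ ⊥ ∧ ∀ h ∈ H, ∀ m ∈ L, π h m ∈ L} ⟨M, le_rfl, hM, hH⟩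
  refine ⟨N, hNM, hN0, hNH, fun L hL hLH => or_iff_not_imp_left.2 fun hL0 => ?_⟩
  have : FiniteDimensional ℂ N := Submodule.finiteDimensional_of_le hNM
  exact Submodule.eq_of_le_of_finrank_le hL (not_lt.1 (hmin L ⟨hL.trans hNM, hL0, hLH⟩))

theorem IsContinuousRep.exists_isInducingSubspace [TopologicalSpace G] [IsTopologicalGroup G]
    [CompleteSpace E] [Nontrivial E] (hG : IsSubgroupOfSInfty G) (hR : IsRoelckePrecompact G)
    (hπ : IsContinuousRep π) : ∃ H V M, IsInducingSubspace π H V M := by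
  obtain ⟨ζ, hζ0, hU, hζ⟩ := hπ.exists_vector_inner_eq_zero hG hR
  set U := vectorStabilizer π ζ with hUdef
  replace hU : IsOpen (U : Set G) := hU
  set H := commensurator U with hH
  have hUH : Commensurable U H := hR.commensurable_commensurator hU
  have hUleH : U ≤ H := le_commensurator U
  have hHH : commensurator H = H := (Commensurable.eq hUH).symm
  -- For `g ∉ H`, the `U`-orbit of `gU` or of `g⁻¹U` is infinite; the two cases are exchanged by
  -- conjugate symmetry of the inner product.
  have horth : ∀ g ∉ H, inner ℂ (π g ζ) ζ = 0 := by
    have key : ∀ g : G, (MulAction.orbit U (g : G ⧸ U)).Infinite → inner ℂ (π g ζ) ζ = 0 :=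
      fun g hg => hζ g (by
        have := setOf_rep_eq_image (π := π) (x := ζ) U g
        change {y | ∃ u ∈ U, π u (π g ζ) = y}.Infinite
        rw [this]
        exact hg.image (injective_rep_out ζ).injOn)
    intro g hg
    rcases infinite_orbit_or_infinite_orbit (V := U) (by simp) hg with h | h
    · exact key g h
    · rw [inner_rep_left, inner_eq_zero_symm]
      exact key _ h
  set S : Set E := {y | ∃ h ∈ H, π h ζ = y} with hS
  have hSfin : S.Finite := by
    have := setOf_rep_eq_image (π := π) (x := ζ) H 1
    simp only [map_one, LinearIsometryEquiv.coe_one, id] at this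
    rw [hS, this]
    exact (hR.finite_orbit_commensurator hU).image _
  have : Finite S := hSfin
  have hζS : ζ ∈ S := ⟨1, H.one_mem, by simp⟩
  have hSH : ∀ h ∈ H, ∀ x ∈ S, π h x ∈ S := by
    rintro h hh _ ⟨k, hk, rfl⟩
    exact ⟨h * k, mul_mem hh hk, rep_mul_apply π h k ζ⟩
  set M := Submodule.span ℂ S with hM
  have : FiniteDimensional ℂ M := FiniteDimensional.span_of_finite ℂ hSfin
  have hMH : ∀ h ∈ H, ∀ x ∈ M, π h x ∈ M := fun h hh x hx =>
    (Submodule.span_le (p := M.comap (π h).toLinearEquiv.toLinearMap)).2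
      (fun y hy => Submodule.subset_span (hSH h hh y hy)) hx
  have hMorth : ∀ g ∉ H, ∀ m ∈ M, ∀ m' ∈ M, inner ℂ (π g m) m' = 0 := by
    intro g hg m hm m' hm'
    induction hm using Submodule.span_induction with
    | zero => simp
    | add x y _ _ hx hy => rw [map_add, inner_add_left, hx, hy, add_zero]
    | smul c x _ hx => rw [map_smul, inner_smul_left, hx, mul_zero]
    | mem x hx =>
      obtain ⟨h, hh, rfl⟩ := hx
      induction hm' using Submodule.span_induction with
      | zero => simp
      | add x y _ _ hx hy => rw [inner_add_right, hx, hy, add_zero]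
      | smul c x _ hx => rw [inner_smul_right, hx, mul_zero]
      | mem y hy =>
        obtain ⟨k, hk, rfl⟩ := hy
        have : k⁻¹ * (g * h) ∉ H := fun hmem => hg (by
          simpa [mul_assoc] using mul_mem (mul_mem hk hmem) (inv_mem hh))
        have := horth _ this
        rwa [rep_mul_apply, inner_rep_left, inv_inv, rep_mul_apply] at this
  -- The pointwise stabilizer of the finite set `H ζ`: normal in `H` because `H` permutes this set,
  -- and commensurable with `U` as a finite intersection of conjugates of `U` by elements of `H =
  -- Comm(U)`.
  set V : Subgroup G := ⨅ x : S, vectorStabilizer π (x : E) with hV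
  have hVU : V ≤ U := iInf_le (fun x : S => vectorStabilizer π (x : E)) ⟨ζ, hζS⟩
  have hVmem : ∀ {g}, g ∈ V ↔ ∀ x ∈ S, π g x = x := fun {g} => by
    simp [hV, mem_iInf, mem_vectorStabilizer]
  have hVU' : V.relIndex U ≠ 0 := by
    refine relIndex_iInf_ne_zero ?_
    rintro ⟨_, h, hh, rfl⟩
    rw [vectorStabilizer_rep]
    exact hh.1
  have hVcomm : Commensurable V U := ⟨hVU', by simp [relIndex_eq_one.2 hVU]⟩
  have hVM : ∀ v ∈ V, ∀ m ∈ M, π v m = m := fun v hv m hm => by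
    induction hm using Submodule.span_induction with
    | zero => simp
    | add x y _ _ hx hy => rw [map_add, hx, hy]
    | smul c x _ hx => rw [map_smul, hx]
    | mem x hx => exact hVmem.1 hv x hx
  obtain ⟨N, hNM, hN0, hNH, hNmin⟩ := exists_minimal_invariant_le (π := π)
    (M := M) (fun h => hζ0 ((Submodule.mem_bot ℂ).1 (h ▸ Submodule.subset_span hζS))) hMH
  refine ⟨H, V, N, (Commensurable.eq hVcomm).symm, hHH, isOpen_mono hUleH hU, ?_,
    hVU.trans hUleH, ⟨(hVcomm.trans hUH).1⟩, ⟨?_⟩, Submodule.finiteDimensional_of_le hNM, hN0, hNH,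
    fun v hv m hm => hVM v hv m (hNM hm), hNmin,
    fun g hg m hm m' hm' => hMorth g hg m (hNM hm) m' (hNM hm')⟩
  · rw [hV, coe_iInf]
    refine isOpen_iInter_of_finite ?_
    rintro ⟨_, h, hh, rfl⟩
    exact isOpen_vectorStabilizer_rep hU h
  · intro n hn h
    rw [mem_subgroupOf] at hn ⊢
    refine hVmem.2 fun x hx => ?_
    simp only [coe_mul, coe_inv, rep_mul_apply]
    rw [hVmem.1 hn _ (hSH _ (inv_mem h.2) x hx), rep_apply_inv_self]

end InducingSubspace

/-! ### Minimal closed invariant subspaces -/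

section Minimal

variable {G : Type*} [Group G] {E : Type*} [NormedAddCommGroup E] [InnerProductSpace ℂ E]
  {π : G →* (E ≃ₗᵢ[ℂ] E)}

/-- `K` is a minimal non-zero closed invariant subspace. -/
structure IsMinimalInvariant (π : G →* (E ≃ₗᵢ[ℂ] E)) (K : Submodule ℂ E) : Prop where
  ne_bot : K ≠ ⊥
  isClosed : IsClosed (K : Set E)
  isInvariant : IsInvariantSubspace π K
  eq_bot_or_eq : ∀ L ≤ K, IsClosed (L : Set E) → IsInvariantSubspace π L → L = ⊥ ∨ L = K

theorem IsInvariantSubspace.orthogonal {K : Submodule ℂ E} (hK : IsInvariantSubspace π K) :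
    IsInvariantSubspace π Kᗮ := fun g x hx y hy => by
  rw [← inner_conj_symm, inner_rep_left, hx _ (hK g⁻¹ y hy) |> inner_eq_zero_symm.1, map_zero]

theorem IsMinimalInvariant.map_subtype {W : Submodule ℂ E} (hWc : IsClosed (W : Set E))
    (hW : IsInvariantSubspace π W) {K : Submodule ℂ W}
    (hK : IsMinimalInvariant (subRep π W hW) K) : IsMinimalInvariant π (K.map W.subtype) where
  ne_bot h := hK.ne_bot (Submodule.map_injective_of_injective W.injective_subtype (h.trans (Submodule.map_bot _).symm))
  isClosed := by
    rw [Submodule.map_coe]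
    exact hWc.isClosedEmbedding_subtypeVal.isClosedMap _ hK.isClosed
  isInvariant := by
    rintro g _ ⟨x, hx, rfl⟩
    exact ⟨_, hK.isInvariant g x hx, rfl⟩
  eq_bot_or_eq L hL hLc hLi := by
    have hLW : L ≤ W := hL.trans (Submodule.map_subtype_le W K)
    have hmap : (L.comap W.subtype).map W.subtype = L := by
      rw [Submodule.map_comap_subtype, inf_eq_right.2 hLW]
    have hle : L.comap W.subtype ≤ K := fun x hx => by
      obtain ⟨y, hy, hyx⟩ := hL hx
      rwa [← W.injective_subtype hyx]
    rcases hK.eq_bot_or_eq (L.comap W.subtype) hle (hLc.preimage continuous_subtype_val)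
      (fun g x hx => hLi g _ hx) with h | h
    · left
      rw [← hmap, h, Submodule.map_bot]
    · right
      rw [← hmap, h]

theorem IsMinimalInvariant.isIrreducibleRep {K : Submodule ℂ E} (hK : IsMinimalInvariant π K) :
    IsIrreducibleRep (subRep π K hK.isInvariant) := by
  refine ⟨(Submodule.nontrivial_iff_ne_bot).2 hK.ne_bot, fun L hLc hLi => ?_⟩
  have hmc : IsClosed (L.map K.subtype : Set E) := by
    rw [Submodule.map_coe]
    exact hK.isClosed.isClosedEmbedding_subtypeVal.isClosedMap _ hLc
  have hmi : IsInvariantSubspace π (L.map K.subtype) := by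
    rintro g _ ⟨x, hx, rfl⟩
    exact ⟨_, hLi g x hx, rfl⟩
  rcases hK.eq_bot_or_eq (L.map K.subtype) (Submodule.map_subtype_le K L) hmc hmi with h | h
  · exact Or.inl (Submodule.map_injective_of_injective K.injective_subtype (h.trans (Submodule.map_bot _).symm))
  · right
    refine Submodule.map_injective_of_injective K.injective_subtype ?_
    rw [h, Submodule.map_subtype_top]

theorem IsContinuousRep.subRep [TopologicalSpace G] (hπ : IsContinuousRep π) {K : Submodule ℂ E}
    (hK : IsInvariantSubspace π K) : IsContinuousRep (subRep π K hK) :=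
  fun ξ => (hπ ξ).subtype_mk _

/-- The closed invariant subspace generated by `M`. -/
def closedInvariantSpan (π : G →* (E ≃ₗᵢ[ℂ] E)) (M : Submodule ℂ E) : Submodule ℂ E :=
  (⨆ g : G, M.map (π g).toLinearEquiv.toLinearMap).topologicalClosure

theorem rep_mem_closedInvariantSpan {M : Submodule ℂ E} {m : E} (hm : m ∈ M) (g : G) :
    π g m ∈ closedInvariantSpan π M :=
  Submodule.le_topologicalClosure _
    (Submodule.mem_iSup_of_mem g (Submodule.mem_map_of_mem hm))

theorem le_closedInvariantSpan (M : Submodule ℂ E) : M ≤ closedInvariantSpan π M := fun m hm => by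
  simpa using rep_mem_closedInvariantSpan (π := π) hm 1

theorem isClosed_closedInvariantSpan (M : Submodule ℂ E) :
    IsClosed (closedInvariantSpan π M : Set E) :=
  Submodule.isClosed_topologicalClosure _

theorem closedInvariantSpan_le {M L : Submodule ℂ E} (hL : IsClosed (L : Set E))
    (h : ∀ g, ∀ m ∈ M, π g m ∈ L) : closedInvariantSpan π M ≤ L :=
  Submodule.topologicalClosure_minimal _
    (iSup_le fun g => Submodule.map_le_iff_le_comap.2 (h g)) hL

theorem isInvariantSubspace_closedInvariantSpan (M : Submodule ℂ E) :
    IsInvariantSubspace π (closedInvariantSpan π M) := fun g x hx =>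
  closedInvariantSpan_le (L := (closedInvariantSpan π M).comap (π g).toLinearEquiv.toLinearMap)
    ((isClosed_closedInvariantSpan M).preimage (π g).continuous)
    (fun h m hm => by
      change π g (π h m) ∈ closedInvariantSpan π M
      rw [← rep_mul_apply]
      exact rep_mem_closedInvariantSpan hm _) hx

/-- Both `L` and its orthogonal complement are invariant. -/
theorem starProjection_rep {L : Submodule ℂ E} [L.HasOrthogonalProjection]
    (hL : IsInvariantSubspace π L) (g : G) (x : E) :
    L.starProjection (π g x) = π g (L.starProjection x) := by
  refine Submodule.eq_starProjection_of_mem_orthogonal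
    (hL g _ (L.starProjection_apply_mem x)) ?_
  rw [← map_sub]
  exact hL.orthogonal g _ (L.sub_starProjection_mem_orthogonal x)

end Minimal

/-! ### Irreducibility of the generated subspace -/

section Irreducible

variable {G : Type*} [Group G] [TopologicalSpace G] {E : Type*} [NormedAddCommGroup E]
  [InnerProductSpace ℂ E] {π : G →* (E ≃ₗᵢ[ℂ] E)} {H V : Subgroup G} {M : Submodule ℂ E}

namespace IsInducingSubspace

theorem inner_rep_rep_eq_zero (hM : IsInducingSubspace π H V M) {a b : G}
    (hab : (a : G ⧸ H) ≠ b) {m m' : E} (hm : m ∈ M) (hm' : m' ∈ M) :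
    inner ℂ (π a m) (π b m') = 0 := by
  have h : b⁻¹ * a ∉ H := fun h => hab (QuotientGroup.eq.2 h).symm
  have := hM.inner_eq_zero _ h m hm m' hm'
  rwa [rep_mul_apply, inner_rep_left, inv_inv] at this

/-- A `V`-fixed vector is orthogonal to the translates `g M` having an infinite `V`-orbit. -/
theorem inner_eq_zero_of_infinite_orbit (hM : IsInducingSubspace π H V M) {g : G}
    (hg : (MulAction.orbit V (g : G ⧸ H)).Infinite) {y : E} (hy : ∀ v ∈ V, π v y = y) {m : E}
    (hm : m ∈ M) : inner ℂ (π g m) y = 0 := by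
  rcases eq_or_ne m 0 with rfl | hm0
  · simp
  have : Infinite (MulAction.orbit V (g : G ⧸ H)) := hg.to_subtype
  choose v hv using fun q : MulAction.orbit V (g : G ⧸ H) => q.2
  replace hv : ∀ q, (((v q : G) * g : G) : G ⧸ H) = q := hv
  let c : ℂ := ((‖m‖⁻¹ : ℝ) : ℂ)
  have hc : ‖c • m‖ = 1 := by simp [c, norm_smul, hm0]
  -- One unit vector for each coset in the orbit; these are orthonormal. Their inner products with
  -- the `V`-fixed vector `y` all agree, so Bessel's inequality over an infinite index set makes
  -- them vanish.
  let w : MulAction.orbit V (g : G ⧸ H) → E := fun q => π (v q * g) (c • m)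
  have hw : Orthonormal ℂ w := by
    refine ⟨fun q => ((π _).norm_map _).trans hc, fun p q hpq => ?_⟩
    refine hM.inner_rep_rep_eq_zero ?_ (M.smul_mem c hm) (M.smul_mem c hm)
    rw [hv, hv]
    exact fun h => hpq (Subtype.ext h)
  have hsum := hw.inner_products_summable (x := y)
  have hconst : (fun q => ‖inner ℂ (w q) y‖ ^ 2) =
      fun _ => ‖inner ℂ (π g (c • m)) y‖ ^ 2 := funext fun q => by
    simp only [w]
    rw [rep_mul_apply, inner_rep_left π (v q : G), hy _ (inv_mem (v q).2)]
  rw [hconst, summable_const_iff, pow_eq_zero_iff two_ne_zero, norm_eq_zero, map_smul,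
    inner_smul_left, mul_eq_zero] at hsum
  exact hsum.resolve_left (by simp [c, hm0])

/-- The projection `P` onto an invariant `L` commutes with `π`, hence sends `M` to `V`-fixed
vectors. These turn out to lie in `M`, so irreducibility of `M` under `H` decides between `P = 0` on
`M` and `M ≤ L`. -/
theorem isMinimalInvariant [CompleteSpace E] (hM : IsInducingSubspace π H V M) :
    IsMinimalInvariant π (closedInvariantSpan π M) where
  ne_bot h := hM.ne_bot (le_bot_iff.1 (h ▸ le_closedInvariantSpan M))
  isClosed := isClosed_closedInvariantSpan M
  isInvariant := isInvariantSubspace_closedInvariantSpan M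
  eq_bot_or_eq L hL hLc hLi := by
    have : CompleteSpace L := hLc.completeSpace_coe
    have := hM.finiteDimensional
    set P := L.starProjection with hP
    have hPL : ∀ x, P x ∈ L := L.starProjection_apply_mem
    have hPfix : ∀ m ∈ M, ∀ v ∈ V, π v (P m) = P m := fun m hm v hv => by
      rw [hP, ← starProjection_rep hLi, hM.rep_eq v hv m hm]
    have horth : ∀ g ∉ H, ∀ m ∈ M, ∀ m' ∈ M, inner ℂ (π g m') (P m) = 0 := by
      intro g hg m hm m' hm'
      rcases infinite_orbit_or_infinite_orbit (V := V) hM.finiteIndex.index_ne_zero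
        (hM.commensurator_eq.symm ▸ hg) with h | h
      · exact hM.inner_eq_zero_of_infinite_orbit h (hPfix m hm) hm'
      -- Self-adjointness of `P` exchanges `g` with `g⁻¹` and `m` with `m'`.
      · rw [hP, ← Submodule.inner_starProjection_left_eq_right, starProjection_rep hLi,
          inner_rep_left, inner_eq_zero_symm]
        exact hM.inner_eq_zero_of_infinite_orbit h (hPfix m' hm') hm
    have hPM : ∀ m ∈ M, P m ∈ M := by
      intro m hm
      set z := P m - M.starProjection (P m) with hz
      have hzM : z ∈ Mᗮ := M.sub_starProjection_mem_orthogonal _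
      have hzK : z ∈ closedInvariantSpan π M := sub_mem (hL (hPL m))
        (le_closedInvariantSpan M (M.starProjection_apply_mem _))
      -- The component `z` of `P m` orthogonal to `M` is orthogonal to every translate of `M`, hence
      -- to the space they span, which contains `z`.
      have hle : closedInvariantSpan π M ≤ (ℂ ∙ z)ᗮ := by
        refine closedInvariantSpan_le (Submodule.isClosed_orthogonal _) fun g m' hm' => ?_
        rw [Submodule.mem_orthogonal_singleton_iff_inner_left]
        by_cases hg : g ∈ H
        · exact hzM _ (hM.rep_mem g hg m' hm')
        · rw [hz, inner_sub_right, horth g hg m hm m' hm',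
            hM.inner_eq_zero g hg m' hm' _ (M.starProjection_apply_mem _), sub_zero]
      have hz0 : z = 0 := by
        have := hle hzK
        rwa [Submodule.mem_orthogonal_singleton_iff_inner_left, inner_self_eq_zero] at this
      rw [sub_eq_zero.1 (hz.symm.trans hz0)]
      exact M.starProjection_apply_mem _
    rcases hM.eq_bot_or_eq (L ⊓ M) inf_le_right
      (fun h hh x hx => ⟨hLi h x hx.1, hM.rep_mem h hh x hx.2⟩) with h | h
    · left
      have hML : ∀ m ∈ M, m ∈ Lᗮ := fun m hm => by
        have h0 : P m = 0 := (Submodule.mem_bot ℂ).1 (h ▸ ⟨hPL m, hPM m hm⟩)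
        simpa [← hP, h0] using L.sub_starProjection_mem_orthogonal m
      have hKL : closedInvariantSpan π M ≤ Lᗮ := closedInvariantSpan_le
        (Submodule.isClosed_orthogonal _) fun g m hm => hLi.orthogonal g m (hML m hm)
      exact disjoint_self.1 (L.orthogonal_disjoint.mono_right (hL.trans hKL))
    · right
      exact le_antisymm hL (closedInvariantSpan_le hLc fun g m hm =>
        hLi g m (inf_eq_right.1 h hm))

end IsInducingSubspace

end Irreducible

/-! ### Realization as an induced representation -/

section Induced

variable {G : Type*} [Group G] {H : Subgroup G} {F : Type*} [NormedAddCommGroup F]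
  [InnerProductSpace ℂ F]

theorem IndSpace.toLp_surjective (σ : H →* (F ≃ₗᵢ[ℂ] F)) :
    Function.Surjective (IndSpace.toLp σ) := fun φ => by
  have hmem : ∀ x : G, x⁻¹ * (x : G ⧸ H).out ∈ H := fun x =>
    QuotientGroup.eq.1 (QuotientGroup.out_eq' _).symm
  -- The value forced by equivariance once `f` is prescribed on the coset representatives.
  let f : G → F := fun x => σ ⟨x⁻¹ * (x : G ⧸ H).out, hmem x⟩ (φ (x : G ⧸ H))
  have hf : ∀ (x : G) (q : G ⧸ H) (_ : (x : G ⧸ H) = q) (h : x⁻¹ * q.out ∈ H),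
      f x = σ ⟨x⁻¹ * q.out, h⟩ (φ q) := by
    rintro x _ rfl _
    rfl
  have hout : (fun q : G ⧸ H => f q.out) = φ := funext fun q => by
    rw [hf q.out q (QuotientGroup.out_eq' q) (by simp)]
    simp only [inv_mul_cancel]
    exact congrArg (fun e : F ≃ₗᵢ[ℂ] F => e (φ q)) (map_one σ)
  refine ⟨⟨f, fun g h => ?_, ?_⟩, Subtype.ext hout⟩
  · have hq : ((g * h : G) : G ⧸ H) = (g : G ⧸ H) := QuotientGroup.mk_mul_of_mem g h.2
    have hmem' : (g * h : G)⁻¹ * (g : G ⧸ H).out ∈ H := by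
      rw [mul_inv_rev, mul_assoc]
      exact mul_mem (inv_mem h.2) (hmem g)
    rw [hf (g * h) _ hq hmem', hf g _ rfl (hmem g), ← rep_mul_apply]
    congr 2
    ext
    simp [mul_assoc]
  · rw [hout]
    exact φ.2

/-- The space of an induced representation is the Hilbert sum of copies of `F`
indexed by the cosets of `H`. -/
noncomputable def IndSpace.equivLp (σ : H →* (F ≃ₗᵢ[ℂ] F)) : IndSpace σ ≃ₗᵢ[ℂ] lp (fun _ : G ⧸ H => F) 2 :=
  LinearIsometryEquiv.ofSurjective ⟨IndSpace.toLp σ, fun _ => rfl⟩ (IndSpace.toLp_surjective σ)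

/-- If the translates of a subspace `M` by the cosets of `H` form a Hilbert sum, then the
representation is induced from the representation of `H` on `M`. -/
theorem areUnitarilyEquivalent_indRep {E : Type*} [NormedAddCommGroup E] [InnerProductSpace ℂ E]
    {π : G →* (E ≃ₗᵢ[ℂ] E)} {σ : H →* (F ≃ₗᵢ[ℂ] F)} [CompleteSpace E] (j : F →ₗᵢ[ℂ] E)
    (hj : ∀ (h : H) (x : F), j (σ h x) = π h (j x))
    (hsum : IsHilbertSum ℂ (fun _ : G ⧸ H => F)
      fun q => (π q.out).toLinearIsometry.comp j) :
    AreUnitarilyEquivalent π (indRep σ) := by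
  let Φ := hsum.linearIsometryEquiv.trans (IndSpace.equivLp σ).symm
  have hΦ : ∀ f : IndSpace σ, Φ.symm f = ∑' q : G ⧸ H, π q.out (j (f q.out)) := fun f =>
    hsum.linearIsometryEquiv_symm_apply _
  -- The summands of `Φ.symm f` do not depend on the representatives, so translation by `g` merely
  -- reindexes the sum.
  have hcoset : ∀ (f : IndSpace σ) (x y : G), (x : G ⧸ H) = y →
      π x (j (f x)) = π y (j (f y)) := fun f x y hxy => by
    have hm : x⁻¹ * y ∈ H := QuotientGroup.eq.1 hxy
    have h1 := f.apply_mul x ⟨x⁻¹ * y, hm⟩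
    simp only [mul_inv_cancel_left] at h1
    rw [h1, hj, ← rep_mul_apply]
    simp
  have hequiv : ∀ (g : G) (f : IndSpace σ), Φ.symm (indRep σ g f) = π g (Φ.symm f) := by
    intro g f
    have h1 := (π g).toContinuousLinearEquiv.map_tsum (L := .unconditional (G ⧸ H))
      (f := fun q : G ⧸ H => π q.out (j (f q.out)))
    simp only [LinearIsometryEquiv.coe_toContinuousLinearEquiv] at h1
    rw [hΦ, hΦ, h1, ← (MulAction.toPerm g⁻¹ : Equiv.Perm (G ⧸ H)).tsum_eq
      fun q => π g (π q.out (j (f q.out)))]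
    refine tsum_congr fun q => ?_
    rw [MulAction.toPerm_apply, hcoset f _ _ (IndSpace.mk_inv_mul_out g q), ← rep_mul_apply,
      mul_inv_cancel_left]
    rfl
  refine ⟨Φ, fun g ξ => ?_⟩
  rw [← Φ.apply_symm_apply (indRep σ g (Φ ξ)), hequiv, Φ.symm_apply_apply]

end Induced

/-! ### Classification of irreducible representations and complete decomposability -/

section Main

variable {G : Type u} [Group G] [TopologicalSpace G] {E : Type v} [NormedAddCommGroup E]
  [InnerProductSpace ℂ E] {π : G →* (E ≃ₗᵢ[ℂ] E)} {H V : Subgroup G} {M : Submodule ℂ E}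

theorem IsInducingSubspace.isHilbertSum [CompleteSpace E] (hM : IsInducingSubspace π H V M)
    (htop : closedInvariantSpan π M = ⊤) :
    IsHilbertSum ℂ (fun _ : G ⧸ H => M)
      fun q => (π q.out).toLinearIsometry.comp M.subtypeₗᵢ := by
  have := hM.finiteDimensional
  refine IsHilbertSum.mk (fun p q hpq m m' => ?_) ?_
  · exact hM.inner_rep_rep_eq_zero (by simpa using hpq) m.2 m'.2
  · rw [← htop, closedInvariantSpan]
    refine Submodule.topologicalClosure_mono (iSup_le fun g => ?_)
    rintro _ ⟨m, hm, rfl⟩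
    have hh : (g : G ⧸ H).out⁻¹ * g ∈ H := QuotientGroup.eq.1 (QuotientGroup.out_eq' _)
    refine Submodule.mem_iSup_of_mem (g : G ⧸ H) ⟨⟨_, hM.rep_mem _ hh m hm⟩, ?_⟩
    change π (g : G ⧸ H).out (π ((g : G ⧸ H).out⁻¹ * g) m) = π g m
    rw [← rep_mul_apply, mul_inv_cancel_left]

theorem IsInducingSubspace.isInducedFromCommensurator [CompleteSpace E]
    (hM : IsInducingSubspace π H V M) (htop : closedInvariantSpan π M = ⊤) :
    IsInducedFromCommensurator π := by
  have := hM.finiteDimensional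
  have hn := hM.normal
  have hinv : IsInvariantSubspace (π.comp H.subtype) M := fun h m hm => hM.rep_mem h h.2 m hm
  let σ₀ : H →* (M ≃ₗᵢ[ℂ] M) := subRep (π.comp H.subtype) M hinv
  let σ : (H ⧸ V.subgroupOf H) →* (M ≃ₗᵢ[ℂ] M) :=
    QuotientGroup.lift (V.subgroupOf H) σ₀ fun v hv => by
      ext m
      exact hM.rep_eq v hv m m.2
  have hσ : σ.comp (QuotientGroup.mk' (V.subgroupOf H)) = σ₀ := by
    ext h m
    rfl
  refine ⟨H, V, hM.eq_commensurator, hM.commensurator_eq, hM.isOpen_left, hM.isOpen_right, hM.le,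
    hM.finiteIndex, hn, M, inferInstance, inferInstance, FiniteDimensional.complete ℂ M, σ,
    ⟨(Submodule.nontrivial_iff_ne_bot).2 hM.ne_bot, fun L _ hL => ?_⟩, ?_⟩
  · have hmi : ∀ h ∈ H, ∀ x ∈ L.map M.subtype, π h x ∈ L.map M.subtype := by
      rintro h hh _ ⟨x, hx, rfl⟩
      exact ⟨_, hL (QuotientGroup.mk ⟨h, hh⟩) x hx, rfl⟩
    rcases hM.eq_bot_or_eq (L.map M.subtype) (Submodule.map_subtype_le M L) hmi with h | h
    · exact Or.inl (Submodule.map_injective_of_injective M.injective_subtype (h.trans (Submodule.map_bot _).symm))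
    · right
      refine Submodule.map_injective_of_injective M.injective_subtype ?_
      rw [h, Submodule.map_subtype_top]
  · rw [hσ]
    exact areUnitarilyEquivalent_indRep M.subtypeₗᵢ (fun _ _ => rfl) (hM.isHilbertSum htop)

variable [IsTopologicalGroup G]

theorem IsIrreducibleRep.isInducedFromCommensurator [CompleteSpace E]
    (hG : IsSubgroupOfSInfty G) (hR : IsRoelckePrecompact G) (hπ : IsContinuousRep π)
    (hirr : IsIrreducibleRep π) : IsInducedFromCommensurator π := by
  have := hirr.1
  obtain ⟨H, V, M, hM⟩ := hπ.exists_isInducingSubspace hG hR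
  exact hM.isInducedFromCommensurator ((hirr.2 _ (isClosed_closedInvariantSpan M)
    (isInvariantSubspace_closedInvariantSpan M)).resolve_left hM.isMinimalInvariant.ne_bot)

theorem IsContinuousRep.exists_isMinimalInvariant_le [CompleteSpace E]
    (hG : IsSubgroupOfSInfty G) (hR : IsRoelckePrecompact G) (hπ : IsContinuousRep π)
    {W : Submodule ℂ E} (hWc : IsClosed (W : Set E)) (hW : IsInvariantSubspace π W)
    (hW0 : W ≠ ⊥) : ∃ K ≤ W, IsMinimalInvariant π K := by
  have : CompleteSpace W := hWc.completeSpace_coe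
  have := (Submodule.nontrivial_iff_ne_bot).2 hW0
  obtain ⟨H, V, M, hM⟩ := (hπ.subRep hW).exists_isInducingSubspace hG hR
  exact ⟨_, Submodule.map_subtype_le W _, hM.isMinimalInvariant.map_subtype hWc hW⟩

/-- Zorn's lemma for sets of pairwise orthogonal minimal subspaces. If a maximal one failed to span
densely, the orthogonal complement would contain another minimal subspace. -/
theorem IsContinuousRep.exists_isHilbertSum [CompleteSpace E]
    (hG : IsSubgroupOfSInfty G) (hR : IsRoelckePrecompact G) (hπ : IsContinuousRep π) :
    ∃ S : Set (Submodule ℂ E), (∀ K ∈ S, IsMinimalInvariant π K) ∧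
      IsHilbertSum ℂ (fun K : S => (K : Submodule ℂ E)) fun K => (K : Submodule ℂ E).subtypeₗᵢ := by
  obtain ⟨S, hS⟩ := zorn_subset
    {S : Set (Submodule ℂ E) | (∀ K ∈ S, IsMinimalInvariant π K) ∧
      S.Pairwise fun K L => K ⟂ L} fun c hc hchain => by
    refine ⟨⋃₀ c, ⟨?_, ?_⟩, fun s hs => Set.subset_sUnion_of_mem hs⟩
    · rintro K ⟨s, hs, hK⟩
      exact (hc hs).1 K hK
    · exact (Set.pairwise_sUnion hchain.directedOn).2 fun s hs => (hc hs).2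
  have hmin := hS.prop.1
  refine ⟨S, hmin, ?_⟩
  have : ∀ K : S, CompleteSpace (K : Submodule ℂ E) := fun K =>
    (hmin K K.2).isClosed.completeSpace_coe
  refine IsHilbertSum.mkInternal _ (fun K L hKL x y => ?_) ?_
  · exact Submodule.isOrtho_iff_inner_eq.1
      (hS.prop.2 K.2 L.2 fun h => hKL (Subtype.ext h)) x x.2 y y.2
  · rw [top_le_iff, Submodule.topologicalClosure_eq_top_iff]
    set W := ⨆ K : S, (K : Submodule ℂ E) with hWdef
    by_contra hne
    have hWinv : IsInvariantSubspace π W := fun g => by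
      change W ≤ W.comap (π g).toLinearEquiv.toLinearMap
      exact iSup_le fun K x hx => Submodule.mem_iSup_of_mem K ((hmin K K.2).isInvariant g x hx)
    obtain ⟨K, hKW, hK⟩ := hπ.exists_isMinimalInvariant_le hG hR
      (Submodule.isClosed_orthogonal W) hWinv.orthogonal hne
    have hperp : ∀ L ∈ S, L ⟂ K := fun L hL =>
      (Submodule.isOrtho_orthogonal_right W).mono (le_iSup (fun K : S => (K : Submodule ℂ E)) ⟨L, hL⟩) hKW
    -- By maximality `K` already belongs to `S`, so it is orthogonal to itself.
    have hKS : K ∈ S := hS.le_of_ge (y := insert K S)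
      ⟨by
        rintro L (rfl | hL)
        exacts [hK, hmin L hL],
       hS.prop.2.insert fun L hL _ => ⟨(hperp L hL).symm, hperp L hL⟩⟩
      (Set.subset_insert K S) (Set.mem_insert K S)
    exact hK.ne_bot (Submodule.isOrtho_self.1 (hperp K hKS))

end Main

theorem mainTheorem1 {G : Type u} [Group G] [TopologicalSpace G] [IsTopologicalGroup G] :
    (IsOligomorphic G → IsSubgroupOfSInfty G ∧ IsRoelckePrecompact G) ∧
    (IsSubgroupOfSInfty G → IsRoelckePrecompact G →
      ∀ (E : Type v) [NormedAddCommGroup E] [InnerProductSpace ℂ E] [CompleteSpace E]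
        (π : G →* (E ≃ₗᵢ[ℂ] E)), IsContinuousRep π →
        (∃ (ι : Type v) (K : ι → Submodule ℂ E) (hK : ∀ i, IsInvariantSubspace π (K i)),
          (∀ i, IsClosed (K i : Set E)) ∧
          IsHilbertSum ℂ (fun i => K i) (fun i => (K i).subtypeₗᵢ) ∧
          ∀ i, IsIrreducibleRep (subRep π (K i) (hK i)) ∧
            IsInducedFromCommensurator (subRep π (K i) (hK i))) ∧
        (IsIrreducibleRep π → IsInducedFromCommensurator π)) := by
  refine ⟨fun h => ⟨h.isSubgroupOfSInfty, h.isRoelckePrecompact⟩,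
    fun hG hR E _ _ _ π hπ => ⟨?_, fun h => h.isInducedFromCommensurator hG hR hπ⟩⟩
  obtain ⟨S, hS, hsum⟩ := hπ.exists_isHilbertSum hG hR
  refine ⟨S, fun K => K, fun K => (hS K K.2).isInvariant, fun K => (hS K K.2).isClosed, hsum,
    fun K => ?_⟩
  have hirr := (hS K K.2).isIrreducibleRep
  have : CompleteSpace (K : Submodule ℂ E) := (hS K K.2).isClosed.completeSpace_coe
  exact ⟨hirr, hirr.isInducedFromCommensurator hG hR (hπ.subRep _)⟩
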